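/- Let $G$ be a group, $L\ge 1$, and $\mathcal T\in\mathrm{Aut}(G)$ with $\mathcal T^L=\mathrm{id}$. Consider a periodic chain whose sites $j\in\mathbb Z/L$ carry the space $\mathbb C^d$, $d\ge 1$, and unitaries $U_{g,j}$ ($g\in G$) forming projective representations, $U_{g,j}U_{h,j}=\nu_j(g,h)\,U_{gh,j}$ with $\nu_j(g,h)\in U(1)$, and transforming under translation as $U_{g,j}\doteq U_{\mathcal T(g),j-1}$, where $\doteq$ denotes equality up to a phase (which may depend on $g$ and $j$). Then each $\nu_j$ is a 2-cocycle and $\nu_j(g,h)=\nu_{j-1}(\mathcal T(g),\mathcal T(h))$ up to a coboundary $\beta(g)\beta(h)\beta(gh)^{-1}$, $\beta:G\to U(1)$. Let $A=(A^s)_{s=1}^d$ be complex $D\times D$ matrices, $D\ge1$, defining on every chain of $N$ sites the translation-invariant matrix product state $|\psi_N\rangle=\sum_{s_1,\dots,s_N}\mathrm{Tr}(A^{s_1}\cdots A^{s_N})|s_1\cdots s_N\rangle$. Call $A$ injective if the transfer map $\mathbb E(X)=\sum_s A^sX(A^s)^\dagger$ has an eigenvalue $r>0$ with a positive definite eigenvector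 $\rho$, its adjoint $X\mapsto\sum_s (A^s)^\dagger XA^s$ has a positive definite eigenvector for $r$, the $r$-eigenspace of $\mathbb E$ is $\mathbb C\rho$, and every other eigenvalue of $\mathbb E$ has modulus $<r$. Call $A$ left-canonical if $\sum_s (A^s)^\dagger A^s=\mathbb 1$. Call $A$ symmetric if for every $g\in G$ and $k\ge 1$, $\mathcal U_g^{(k)}|\psi_{kL}\rangle=e^{i\theta}|\psi_{kL}\rangle$ for some real $\theta=\theta(g,k)$, where $\mathcal U_g^{(k)}$ is the tensor product over the $kL$ sites of the $L$-periodically repeated unitaries $U_{g,j}$. (i) If $A$ is injective, left-canonical and symmetric, then there are $D\times D$ unitaries $v_j(g)$ on the bonds $j\in\mathbb Z/L$ such that, for all $j,g$, $$\sum_{s'}(U_{g,j})_{ss'}A^{s'}\doteq v_{j-1}(g)^\dagger A^s v_j(g),$$ with a phase independent of $s$. For every such family, $v_j(g)\doteq v_{j-1}(\mathcal T(g))$, and there are 2-cocycles $\omega_j:G\times G\to U(1)$ with $v_j(g)v_j(h)=\omega_j(g,h)v_j(gh)$ such that, for all $j$, up to coboundaries, $$\omega_j(g,h)=\nu_j(g,h)\,\omega_{j-1}(g,h),\qquad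 \omega_j(g,h)=\omega_{j-1}(\mathcal T(g),\mathcal T(h)).$$ (ii) (LSM-type obstruction.) If there is no family of 2-cocycles $\omega_j:G\times G\to U(1)$, $j\in\mathbb Z/L$, satisfying these two equations up to coboundaries for all $j$, then there is no injective symmetric $A$ of any bond dimension $D\ge1$, left-canonical or not. -/

import Mathlib

open scoped Matrix ComplexOrder

namespace ModulatedMPS

/-! ### Cocycles with values in `U(1)` (trivial action) -/

/-- `ω : G × G → U(1)` is a 2-cocycle. -/
def IsTwoCocycle {G : Type*} [Group G] (ω : G → G → Circle) : Prop :=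
  ∀ g h k : G, ω g h * ω (g * h) k = ω h k * ω g (h * k)

/-- `ω` and `ω'` agree up to a coboundary `β(g) β(h) β(gh)⁻¹`. -/
def EqUpToCoboundary {G : Type*} [Group G] (ω ω' : G → G → Circle) : Prop :=
  ∃ β : G → Circle, ∀ g h : G, ω g h = ω' g h * (β g * β h * (β (g * h))⁻¹)

/-! ### Translation-invariant matrix product states

An MPS tensor with physical dimension `d` and bond dimension `D` is a family
`A : Fin d → Matrix (Fin D) (Fin D) ℂ`, the same on every site. -/

/-- The periodic MPS on `N` sites, in the product basis:
`ψ(s₁, …, s_N) = Tr (A^{s₁} ⋯ A^{s_N})`. -/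
def mpsState {d D : ℕ} (A : Fin d → Matrix (Fin D) (Fin D) ℂ) (N : ℕ) :
    (Fin N → Fin d) → ℂ :=
  fun s => ((List.ofFn fun i => A (s i)).prod).trace

/-- The transfer matrix `∑ₛ Aˢ ⊗ (Aˢ)*`, as the linear map `X ↦ ∑ₛ Aˢ X (Aˢ)†`. -/
noncomputable def transferMap {d D : ℕ} (A : Fin d → Matrix (Fin D) (Fin D) ℂ) :
    Module.End ℂ (Matrix (Fin D) (Fin D) ℂ) :=
  ∑ s, LinearMap.mulLeft ℂ (A s) ∘ₗ LinearMap.mulRight ℂ (A s)ᴴ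

/-- Injectivity: the transfer matrix has a dominant eigenvalue `r > 0` with positive definite right
and left eigenvectors `ρ` and `Λ`; the eigenvector is unique up to scalars, and every other
eigenvalue is strictly smaller in modulus. -/
def IsInjective {d D : ℕ} (A : Fin d → Matrix (Fin D) (Fin D) ℂ) : Prop :=
  ∃ r : ℝ, 0 < r ∧ ∃ ρ Λ : Matrix (Fin D) (Fin D) ℂ,
    ρ.PosDef ∧ Λ.PosDef ∧
    transferMap A ρ = (r : ℂ) • ρ ∧
    ∑ s, (A s)ᴴ * Λ * A s = (r : ℂ) • Λ ∧
    ∀ (μ : ℂ) (X : Matrix (Fin D) (Fin D) ℂ), (transferMap A).HasEigenvector μ X →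
      (μ = (r : ℂ) ∧ ∃ c : ℂ, X = c • ρ) ∨ ‖μ‖ < r

/-- Left-canonical form: the identity is a left eigenvector of the transfer matrix with
eigenvalue one. -/
def IsLeftCanonical {d D : ℕ} (A : Fin d → Matrix (Fin D) (Fin D) ℂ) : Prop :=
  ∑ s, (A s)ᴴ * A s = 1

/-! ### On-site symmetries

Sites (and bonds) of the periodic chain of length `L` are labelled by `ZMod L`; bond `j` lies
between the sites `j` and `j + 1`. -/

/-- The operator `W₁ ⊗ ⋯ ⊗ W_N` on `(ℂ^d)^{⊗ N}`, in the product basis. -/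
def tensorOp {d N : ℕ} (W : Fin N → Matrix (Fin d) (Fin d) ℂ) :
    Matrix (Fin N → Fin d) (Fin N → Fin d) ℂ :=
  Matrix.of fun s t => ∏ i, W i (s i) (t i)

/-- The MPS is symmetric: for every `k ≥ 1`, the MPS on `k L` sites is an eigenstate, with an
eigenvalue of modulus one, of the `k`-fold periodic extension of `⨂ⱼ U_{g,j}`. -/
def IsSymmetric {G : Type*} {d D L : ℕ}
    (U : ZMod L → G → Matrix.unitaryGroup (Fin d) ℂ)
    (A : Fin d → Matrix (Fin D) (Fin D) ℂ) : Prop :=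
  ∀ (g : G) (k : ℕ), 0 < k → ∃ θ : Circle,
    tensorOp (fun i : Fin (k * L) => (U ((i : ℕ) : ZMod L) g : Matrix (Fin d) (Fin d) ℂ)) *ᵥ
        mpsState A (k * L)
      = (θ : ℂ) • mpsState A (k * L)

/-- `U` is a projective representation of `G` on every site, with phases `ν`:
`U_{g,j} U_{h,j} = ν_j(g,h) U_{gh,j}`. (Used for the physical sites and for the bonds.) -/
def IsProjectiveRep {G : Type*} [Group G] {n L : ℕ}
    (U : ZMod L → G → Matrix.unitaryGroup (Fin n) ℂ) (ν : ZMod L → G → G → Circle) : Prop :=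
  ∀ (j : ZMod L) (g h : G),
    (U j g * U j h : Matrix (Fin n) (Fin n) ℂ) =
      (ν j g h : ℂ) • (U j (g * h) : Matrix (Fin n) (Fin n) ℂ)

/-- Compatibility with translation, up to phases: `U_{g,j} ≐ U_{T(g),j-1}`. -/
def IsCovariant {G : Type*} [Group G] {n L : ℕ} (T : MulAut G)
    (U : ZMod L → G → Matrix.unitaryGroup (Fin n) ℂ) : Prop :=
  ∀ (j : ZMod L) (g : G), ∃ c : Circle,
    (U j g : Matrix (Fin n) (Fin n) ℂ) = (c : ℂ) • (U (j - 1) (T g) : Matrix (Fin n) (Fin n) ℂ)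

/-- The push-through condition `U_{g,j} · A ≐ v_{j-1}(g)† A v_j(g)`, up to a phase which may depend
on `g` and `j`. -/
def PushThrough {G : Type*} {d D L : ℕ}
    (U : ZMod L → G → Matrix.unitaryGroup (Fin d) ℂ)
    (A : Fin d → Matrix (Fin D) (Fin D) ℂ)
    (v : ZMod L → G → Matrix.unitaryGroup (Fin D) ℂ) : Prop :=
  ∀ (j : ZMod L) (g : G), ∃ c : Circle, ∀ s : Fin d,
    ∑ s', (U j g : Matrix (Fin d) (Fin d) ℂ) s s' • A s' =
      (c : ℂ) • ((v (j - 1) g : Matrix (Fin D) (Fin D) ℂ)ᴴ * A s *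
        (v j g : Matrix (Fin D) (Fin D) ℂ))

/-- The two constraints, up to coboundaries:
`ω_j(g,h) = ν_j(g,h) ω_{j-1}(g,h)` and `ω_j(g,h) = ω_{j-1}(T(g),T(h))`. -/
def SatisfiesConstraints {G : Type*} [Group G] {L : ℕ} (T : MulAut G)
    (ν ω : ZMod L → G → G → Circle) : Prop :=
  ∀ j : ZMod L,
    EqUpToCoboundary (ω j) (fun g h => ν j g h * ω (j - 1) g h) ∧
    EqUpToCoboundary (ω j) (fun g h => ω (j - 1) (T g) (T h))

end ModulatedMPS

namespace ModulatedMPS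

open Filter Topology

variable {d D L : ℕ}

/-! ### Powers of linear maps with small spectrum -/

/-! For a left-canonical injective tensor the transfer map `E` preserves the trace and `E ^ n`
converges to `X ↦ tr(X) ρ`, so `⟨ψ_N|ψ_N⟩ = tr (E ^ N)` tends to 1. Fix `g`, put `B_j = U_{g,j} ·
A`, and let `M` be the product over one cell of the mixed maps `X ↦ ∑ₛ B_jˢ X (Aˢ)†`. Symmetry gives
`|tr (M ^ k)| → 1`, hence `M` has an eigenvalue of modulus at least 1
(`exists_hasEigenvector_prod_mixedMap`). Each mixed map contracts the norm `tr(Z ρ Z†)`, with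
equality only for exact intertwiners (`trace_sum_intertwining_defect`). An eigenvector carried
around the cell therefore saturates every inequality, and the resulting intertwiners are multiples
of unitaries because the identity is the only dual fixed point up to scalars. They yield the bond
unitaries (`exists_unitary_pushThrough`).

The constraints come from rigidity: two families of bond unitaries with the same action up to phases
`c_j` differ by phases with `w_j = c_j w_{j-1}` (`exists_phases_of_conj_eq`). Comparing `v_j(g)`
with `v_{j-1}(T g)` gives covariance. Comparing `v_j(g) v_j(h)` with `v_j(gh)` produces `ω_j`, and
the recursion becomes `ω_j = ν_j ω_{j-1}` up to a coboundary.

The obstruction is the contrapositive, once a gauge change has made an arbitrary injective tensor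
left-canonical (`exists_leftCanonical`). -/

theorem tendsto_pow_zero_of_spectralRadius_lt_one {R : Type*} [NormedRing R] [NormedAlgebra ℂ R]
    [CompleteSpace R] {a : R} (ha : spectralRadius ℂ a < 1) :
    Tendsto (fun n : ℕ => a ^ n) atTop (𝓝 0) := by
  obtain ⟨q, hq, hq1⟩ := ENNReal.lt_iff_exists_nnreal_btwn.1 ha
  rw [tendsto_zero_iff_norm_tendsto_zero]
  have hq1' : (q : ℝ) < 1 := by exact_mod_cast hq1
  refine squeeze_zero' (Eventually.of_forall fun n => norm_nonneg _) ?_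
    (tendsto_pow_atTop_nhds_zero_of_lt_one q.coe_nonneg hq1')
  filter_upwards [(spectrum.pow_nnnorm_pow_one_div_tendsto_nhds_spectralRadius a).eventually_lt_const
    hq, eventually_gt_atTop 0] with n hn hn0
  have h : (‖a ^ n‖₊ : ENNReal) ≤ (q : ENNReal) ^ n := by
    have hn1 : (1 / n : ℝ) * n = 1 := by field_simp
    calc (‖a ^ n‖₊ : ENNReal) = ((‖a ^ n‖₊ : ENNReal) ^ (1 / n : ℝ)) ^ n := by
          rw [← ENNReal.rpow_natCast, ← ENNReal.rpow_mul, hn1, ENNReal.rpow_one]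
      _ ≤ _ := pow_le_pow_left' hn.le n
  have h' : ‖a ^ n‖₊ ≤ q ^ n := by exact_mod_cast h
  exact_mod_cast h'

/-- Gelfand's formula after passing to matrices. Testing against a functional `φ` avoids choosing a
norm on `Module.End ℂ V`. -/
theorem tendsto_pow_end_of_forall_hasEigenvector {V : Type*} [AddCommGroup V] [Module ℂ V]
    [FiniteDimensional ℂ V] (F : Module.End ℂ V)
    (hF : ∀ μ X, F.HasEigenvector μ X → ‖μ‖ < 1) (φ : Module.End ℂ V →ₗ[ℂ] ℂ) :
    Tendsto (fun n : ℕ => φ (F ^ n)) atTop (𝓝 0) := by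
  let : NormedRing (Matrix (Fin (Module.finrank ℂ V)) (Fin (Module.finrank ℂ V)) ℂ) :=
    Matrix.linftyOpNormedRing
  let : NormedAlgebra ℂ (Matrix (Fin (Module.finrank ℂ V)) (Fin (Module.finrank ℂ V)) ℂ) :=
    Matrix.linftyOpNormedAlgebra
  have : CompleteSpace (Matrix (Fin (Module.finrank ℂ V)) (Fin (Module.finrank ℂ V)) ℂ) :=
    FiniteDimensional.complete ℂ _
  let e := LinearMap.toMatrixAlgEquiv (Module.finBasis ℂ V)
  have hr : spectralRadius ℂ (e F) < 1 := by
    rcases subsingleton_or_nontrivial V with h | h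
    · have : e F = 0 := by
        rw [Subsingleton.elim F 0, map_zero]
      rw [this]; simp
    · have : Nontrivial (Matrix (Fin (Module.finrank ℂ V)) (Fin (Module.finrank ℂ V)) ℂ) :=
        e.symm.toEquiv.nontrivial
      rw [← ENNReal.coe_one]
      refine spectrum.spectralRadius_lt_of_forall_lt _ fun μ hμ => ?_
      rw [AlgEquiv.spectrum_eq] at hμ
      obtain ⟨X, hX⟩ := (Module.End.HasEigenvalue.of_mem_spectrum hμ).exists_hasEigenvector
      exact_mod_cast hF μ X hX
  have h1 := tendsto_pow_zero_of_spectralRadius_lt_one hr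
  let ψ := φ ∘ₗ e.symm.toLinearMap
  have h2 := ((LinearMap.continuous_of_finiteDimensional ψ).tendsto 0).comp h1
  rw [map_zero] at h2
  refine h2.congr fun n => ?_
  simp [ψ, ← map_pow]

/-! ### The transfer map of a left-canonical injective tensor -/

theorem transferMap_apply (A : Fin d → Matrix (Fin D) (Fin D) ℂ) (X : Matrix (Fin D) (Fin D) ℂ) :
    transferMap A X = ∑ s, A s * X * (A s)ᴴ := by
  simp [transferMap, Matrix.mul_assoc]

theorem trace_transferMap {A : Fin d → Matrix (Fin D) (Fin D) ℂ} (hA : IsLeftCanonical A)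
    (X : Matrix (Fin D) (Fin D) ℂ) : (transferMap A X).trace = X.trace := by
  rw [transferMap_apply, Matrix.trace_sum]
  simp_rw [fun s => Matrix.trace_mul_cycle (A s) X (A s)ᴴ]
  rw [← Matrix.trace_sum, ← Finset.sum_mul, hA, one_mul]

/-- A density matrix `ρ` is the unique dominant fixed point of the transfer map of a left-canonical
tensor. -/
structure IsDominantState (A : Fin d → Matrix (Fin D) (Fin D) ℂ)
    (ρ : Matrix (Fin D) (Fin D) ℂ) : Prop where
  posDef : ρ.PosDef
  trace_eq : ρ.trace = 1
  fixed : transferMap A ρ = ρ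
  dominant : ∀ μ X, (transferMap A).HasEigenvector μ X → (μ = 1 ∧ ∃ c : ℂ, X = c • ρ) ∨ ‖μ‖ < 1

/-- Trace preservation forces `r = 1`, because a positive definite `ρ` has nonzero trace. -/
theorem exists_isDominantState (hD : 0 < D) {A : Fin d → Matrix (Fin D) (Fin D) ℂ}
    (hA : IsInjective A) (hc : IsLeftCanonical A) : ∃ ρ, IsDominantState A ρ := by
  have : Nonempty (Fin D) := ⟨⟨0, hD⟩⟩
  obtain ⟨r, hr, ρ, -, hρ, -, hfix, -, hdom⟩ := hA
  have htr := hρ.trace_pos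
  have hr1 : r = 1 := by
    have h := trace_transferMap hc ρ
    rw [hfix, Matrix.trace_smul, smul_eq_mul] at h
    have := mul_right_cancel₀ htr.ne' (h.trans (one_mul _).symm)
    exact_mod_cast this
  subst hr1
  refine ⟨ρ.trace⁻¹ • ρ, hρ.smul (inv_pos.2 htr), ?_, ?_, fun μ X hX => ?_⟩
  · rw [Matrix.trace_smul, smul_eq_mul, inv_mul_cancel₀ htr.ne']
  · rw [map_smul, hfix]; simp
  · refine (hdom μ X hX).imp (fun ⟨h1, c, h2⟩ => ⟨by simpa using h1, c * ρ.trace, ?_⟩) id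
    rw [h2, smul_smul, mul_assoc, mul_inv_cancel₀ htr.ne', mul_one]

/-- The limit `P` is the spectral projection at eigenvalue 1: it absorbs `E` on both sides, and
removing it leaves only spectrum inside the open unit disc. -/
theorem IsDominantState.tendsto_pow {A : Fin d → Matrix (Fin D) (Fin D) ℂ}
    {ρ : Matrix (Fin D) (Fin D) ℂ} (hc : IsLeftCanonical A) (h : IsDominantState A ρ)
    (φ : Module.End ℂ (Matrix (Fin D) (Fin D) ℂ) →ₗ[ℂ] ℂ) :
    Tendsto (fun n : ℕ => φ (transferMap A ^ n)) atTop
      (𝓝 (φ ((Matrix.traceLinearMap (Fin D) ℂ ℂ).smulRight ρ))) := by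
  set P := (Matrix.traceLinearMap (Fin D) ℂ ℂ).smulRight ρ with hP
  set E := transferMap A with hE
  have hPa : ∀ X, P X = X.trace • ρ := fun X => by simp [hP]
  have hEP : E * P = P := by
    ext1 X
    rw [Module.End.mul_apply, hPa, map_smul, h.fixed]
  have hPE : P * E = P := by
    ext1 X
    rw [Module.End.mul_apply, hPa, hPa, trace_transferMap hc]
  have hPP : P * P = P := by
    ext1 X
    rw [Module.End.mul_apply, hPa, hPa, Matrix.trace_smul, h.trace_eq, smul_eq_mul, mul_one]
  -- The exponent must be positive: at exponent 0 the two sides differ by `P`.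
  have hpow : ∀ n : ℕ, (E - P) ^ (n + 1) = E ^ (n + 1) - P := by
    intro n
    induction n with
    | zero => simp
    | succ n ih =>
      have hEnP : E ^ (n + 1) * P = P := by
        clear ih
        induction n with
        | zero => simpa using hEP
        | succ n ih => rw [pow_succ, mul_assoc, hEP, ih]
      rw [pow_succ, ih, sub_mul, mul_sub, mul_sub, hEnP, hPE, hPP, ← pow_succ]
      simp
  -- `E - P` kills traces, so either `μ = 0` or `X` is a traceless eigenvector of `E`, which cannot
  -- be a multiple of `ρ`.
  have hlim := tendsto_pow_end_of_forall_hasEigenvector (E - P) (fun μ X hX => by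
    have hXe := hX.apply_eq_smul
    have htr := congrArg Matrix.trace hXe
    rw [LinearMap.sub_apply, hPa, Matrix.trace_sub, trace_transferMap hc, Matrix.trace_smul,
      h.trace_eq, Matrix.trace_smul, smul_eq_mul, smul_eq_mul, mul_one, sub_self] at htr
    rcases mul_eq_zero.1 htr.symm with h0 | h0
    · simp [h0]
    · rw [LinearMap.sub_apply, hPa, h0, zero_smul, sub_zero] at hXe
      rcases h.dominant μ X ⟨Module.End.mem_eigenspace_iff.2 hXe, hX.2⟩ with ⟨-, c, hcX⟩ | hlt
      · rw [hcX, Matrix.trace_smul, h.trace_eq, smul_eq_mul, mul_one] at h0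
        exact absurd (by rw [hcX, h0, zero_smul]) hX.2
      · exact hlt) φ
  rw [← tendsto_add_atTop_iff_nat 1]
  have h2 := ((tendsto_add_atTop_iff_nat 1).2 hlim).add_const (φ P)
  rw [zero_add] at h2
  refine h2.congr fun n => ?_
  rw [hpow, map_sub, sub_add_cancel]

theorem IsDominantState.tendsto_pow_apply {A : Fin d → Matrix (Fin D) (Fin D) ℂ}
    {ρ : Matrix (Fin D) (Fin D) ℂ} (hc : IsLeftCanonical A) (h : IsDominantState A ρ)
    (X : Matrix (Fin D) (Fin D) ℂ) (ψ : Matrix (Fin D) (Fin D) ℂ →ₗ[ℂ] ℂ) :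
    Tendsto (fun n : ℕ => ψ ((transferMap A ^ n) X)) atTop (𝓝 (X.trace * ψ ρ)) := by
  simpa using h.tendsto_pow hc (ψ ∘ₗ LinearMap.applyₗ X)

theorem IsDominantState.tendsto_trace_pow {A : Fin d → Matrix (Fin D) (Fin D) ℂ}
    {ρ : Matrix (Fin D) (Fin D) ℂ} (hc : IsLeftCanonical A) (h : IsDominantState A ρ) :
    Tendsto (fun n : ℕ => LinearMap.trace ℂ _ (transferMap A ^ n)) atTop (𝓝 1) := by
  simpa [LinearMap.trace_smulRight, h.trace_eq] using
    h.tendsto_pow hc (LinearMap.trace ℂ (Matrix (Fin D) (Fin D) ℂ))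

theorem trace_transferMap_pow {A : Fin d → Matrix (Fin D) (Fin D) ℂ} (hA : IsLeftCanonical A)
    (n : ℕ) (X : Matrix (Fin D) (Fin D) ℂ) : ((transferMap A ^ n) X).trace = X.trace := by
  induction n generalizing X with
  | zero => simp
  | succ n ih => rw [pow_succ, Module.End.mul_apply, ih, trace_transferMap hA]

theorem IsDominantState.pow_apply_self {A : Fin d → Matrix (Fin D) (Fin D) ℂ}
    {ρ : Matrix (Fin D) (Fin D) ℂ} (h : IsDominantState A ρ) (n : ℕ) :
    (transferMap A ^ n) ρ = ρ := by
  induction n with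
  | zero => simp
  | succ n ih => rw [pow_succ, Module.End.mul_apply, h.fixed, ih]

/-- Up to scalars, `ρ` is the only eigenvector of a power of the transfer map with an eigenvalue on
the unit circle. -/
theorem IsDominantState.eq_smul_of_pow_apply {A : Fin d → Matrix (Fin D) (Fin D) ℂ}
    {ρ : Matrix (Fin D) (Fin D) ℂ} (hc : IsLeftCanonical A) (h : IsDominantState A ρ)
    {L : ℕ} (hL : 0 < L) {X : Matrix (Fin D) (Fin D) ℂ} {lam : ℂ} (hlam : ‖lam‖ = 1)
    (hX : (transferMap A ^ L) X = lam • X) : X = X.trace • ρ := by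
  have hXt : lam * X.trace = X.trace := by
    rw [← smul_eq_mul, ← Matrix.trace_smul, ← hX, trace_transferMap_pow hc]
  set Y := X - X.trace • ρ with hY
  have hYt : Y.trace = 0 := by
    rw [hY, Matrix.trace_sub, Matrix.trace_smul, h.trace_eq, smul_eq_mul, mul_one, sub_self]
  have hEY : (transferMap A ^ L) Y = lam • Y := by
    rw [hY, map_sub, map_smul, hX, h.pow_apply_self, smul_sub, smul_smul, hXt]
  -- Entries of constant modulus along this orbit contradict its convergence to 0 for traceless `Y`,
  -- unless `Y = 0`.
  have hk : ∀ k : ℕ, (transferMap A ^ (L * k)) Y = lam ^ k • Y := by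
    intro k
    induction k with
    | zero => simp
    | succ k ih => rw [mul_add, mul_one, pow_add, Module.End.mul_apply, hEY, map_smul, ih,
        smul_smul, pow_succ']
  suffices Y = 0 from sub_eq_zero.1 this
  ext i j
  have hlim := (h.tendsto_pow_apply hc Y (Matrix.entryLinearMap ℂ ℂ i j)).comp
    (tendsto_id.const_mul_atTop' hL)
  rw [hYt, zero_mul] at hlim
  have hlim' := hlim.norm
  have hconst : ∀ k : ℕ, ‖((fun n => (Matrix.entryLinearMap ℂ ℂ i j) ((transferMap A ^ n) Y)) ∘
      fun x => L * id x) k‖ = ‖Y i j‖ := by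
    intro k
    simp [hk, hlam]
  rw [tendsto_congr hconst, norm_zero] at hlim'
  simpa using tendsto_nhds_unique tendsto_const_nhds hlim'

/-- Up to scalars, the identity is the only fixed point of a power of the dual transfer map. -/
theorem IsDominantState.eq_smul_one_of_iterate_dual {A : Fin d → Matrix (Fin D) (Fin D) ℂ}
    {ρ : Matrix (Fin D) (Fin D) ℂ} (hc : IsLeftCanonical A) (h : IsDominantState A ρ)
    {L : ℕ} (hL : 0 < L) {K : Matrix (Fin D) (Fin D) ℂ}
    (hK : (fun Y => ∑ s, (A s)ᴴ * Y * A s)^[L] K = K) : K = (K * ρ).trace • 1 := by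
  have hdual : ∀ (n : ℕ) (Y X : Matrix (Fin D) (Fin D) ℂ),
      ((fun Y => ∑ s, (A s)ᴴ * Y * A s)^[n] Y * X).trace = (Y * (transferMap A ^ n) X).trace := by
    intro n
    induction n with
    | zero => simp
    | succ n ih =>
      intro Y X
      rw [Function.iterate_succ_apply, ih, pow_succ', Module.End.mul_apply, transferMap_apply,
        Finset.sum_mul, Finset.mul_sum, Matrix.trace_sum, Matrix.trace_sum]
      refine Finset.sum_congr rfl fun s _ => ?_
      rw [Matrix.mul_assoc, Matrix.mul_assoc, Matrix.trace_mul_comm]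
      simp only [Matrix.mul_assoc]
  have hk : ∀ (k : ℕ) X, (K * (transferMap A ^ (L * k)) X).trace = (K * X).trace := by
    intro k X
    rw [← hdual, Function.iterate_mul, Function.iterate_fixed hK]
  have key : ∀ X, (K * X).trace = X.trace * (K * ρ).trace := by
    intro X
    have hlim := (h.tendsto_pow_apply hc X
      (Matrix.traceLinearMap (Fin D) ℂ ℂ ∘ₗ LinearMap.mulLeft ℂ K)).comp
      (tendsto_id.const_mul_atTop' hL)
    have hconst : ∀ k : ℕ, ((fun n => (Matrix.traceLinearMap (Fin D) ℂ ℂ ∘ₗ LinearMap.mulLeft ℂ K)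
        ((transferMap A ^ n) X)) ∘ fun x => L * id x) k = (K * X).trace := by
      intro k
      simp [hk]
    rw [tendsto_congr hconst] at hlim
    simpa using tendsto_nhds_unique tendsto_const_nhds hlim
  refine Matrix.ext_iff_trace_mul_right.2 fun X => ?_
  rw [key, Matrix.smul_mul, Matrix.trace_smul, one_mul, smul_eq_mul, mul_comm]

/-! ### Intertwiners -/

/-- The mixed transfer map `X ↦ ∑ₛ Bˢ X (Aˢ)†`. -/
noncomputable def mixedMap (B A : Fin d → Matrix (Fin D) (Fin D) ℂ) :
    Module.End ℂ (Matrix (Fin D) (Fin D) ℂ) :=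
  ∑ s, LinearMap.mulLeft ℂ (B s) ∘ₗ LinearMap.mulRight ℂ (A s)ᴴ

theorem mixedMap_apply (B A : Fin d → Matrix (Fin D) (Fin D) ℂ) (X : Matrix (Fin D) (Fin D) ℂ) :
    mixedMap B A X = ∑ s, B s * X * (A s)ᴴ := by
  simp [mixedMap, Matrix.mul_assoc]

/-- Expanding the square, `B` left-canonical gives the `Z` term, while both cross terms and the last
square each equal `tr(Y ρ Y†)`. This yields the contraction property and its equality case at once.
-/
theorem trace_sum_intertwining_defect {A B : Fin d → Matrix (Fin D) (Fin D) ℂ}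
    {ρ Y Z : Matrix (Fin D) (Fin D) ℂ} (hB : IsLeftCanonical B) (hρ : ρ.IsHermitian)
    (hfix : transferMap A ρ = ρ) (hY : mixedMap B A (Z * ρ) = Y * ρ) :
    ∑ s, ((B s * Z - Y * A s) * ρ * (B s * Z - Y * A s)ᴴ).trace =
      (Z * ρ * Zᴴ).trace - (Y * ρ * Yᴴ).trace := by
  rw [transferMap_apply] at hfix
  rw [mixedMap_apply] at hY
  have h1 : ∑ s, (B s * Z * ρ * (B s * Z)ᴴ).trace = (Z * ρ * Zᴴ).trace := by
    have : ∀ s, (B s * Z * ρ * (B s * Z)ᴴ).trace = ((B s)ᴴ * B s * (Z * ρ * Zᴴ)).trace := by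
      intro s
      rw [Matrix.conjTranspose_mul, ← Matrix.mul_assoc, Matrix.trace_mul_comm]
      simp only [Matrix.mul_assoc]
    simp_rw [this]
    rw [← Matrix.trace_sum, ← Finset.sum_mul, hB, one_mul]
  have h2 : ∑ s, (B s * Z * ρ * (Y * A s)ᴴ).trace = (Y * ρ * Yᴴ).trace := by
    rw [← hY, Finset.sum_mul, Matrix.trace_sum]
    simp only [Matrix.conjTranspose_mul, Matrix.mul_assoc]
  have h3 : ∑ s, (Y * A s * ρ * (B s * Z)ᴴ).trace = (Y * ρ * Yᴴ).trace := by
    have := congrArg star h2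
    rw [star_sum] at this
    simpa [← Matrix.trace_conjTranspose, Matrix.conjTranspose_mul, hρ.eq, Matrix.mul_assoc]
      using this
  have h4 : ∑ s, (Y * A s * ρ * (Y * A s)ᴴ).trace = (Y * ρ * Yᴴ).trace := by
    conv_rhs => rw [← hfix, Finset.mul_sum, Finset.sum_mul, Matrix.trace_sum]
    simp only [Matrix.conjTranspose_mul, Matrix.mul_assoc]
  simp_rw [Matrix.conjTranspose_sub, sub_mul, mul_sub, Matrix.trace_sub, Finset.sum_sub_distrib]
  rw [h1, h2, h3, h4]
  ring

theorem trace_mul_mul_conjTranspose_nonneg {ρ : Matrix (Fin D) (Fin D) ℂ} (hρ : ρ.PosDef)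
    (Z : Matrix (Fin D) (Fin D) ℂ) : 0 ≤ (Z * ρ * Zᴴ).trace :=
  (hρ.posSemidef.mul_mul_conjTranspose_same Z).trace_nonneg

theorem trace_mul_mul_conjTranspose_eq_zero {ρ : Matrix (Fin D) (Fin D) ℂ} (hρ : ρ.PosDef)
    {Z : Matrix (Fin D) (Fin D) ℂ} (h : (Z * ρ * Zᴴ).trace = 0) : Z = 0 := by
  rw [(hρ.posSemidef.mul_mul_conjTranspose_same Z).trace_eq_zero_iff] at h
  by_contra hZ
  obtain ⟨i, hi⟩ : ∃ i, Z i ≠ 0 := by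
    by_contra! h'
    exact hZ (funext h')
  have hx : star (Z i) ≠ 0 := by simpa using hi
  have hpos := hρ.dotProduct_mulVec_pos hx
  -- A diagonal entry is the quadratic form of `ρ` at a conjugated row of `Z`.
  have h0 : (Z * ρ * Zᴴ) i i = star (star (Z i)) ⬝ᵥ (ρ *ᵥ star (Z i)) := by
    rw [Matrix.mul_assoc, star_star]
    rfl
  rw [← h0, h] at hpos
  simp at hpos

theorem trace_mixedMap_le {A B : Fin d → Matrix (Fin D) (Fin D) ℂ}
    {ρ Y Z : Matrix (Fin D) (Fin D) ℂ} (hB : IsLeftCanonical B) (hρ : ρ.PosDef)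
    (hfix : transferMap A ρ = ρ) (hY : mixedMap B A (Z * ρ) = Y * ρ) :
    (Y * ρ * Yᴴ).trace ≤ (Z * ρ * Zᴴ).trace := by
  rw [← sub_nonneg, ← trace_sum_intertwining_defect hB hρ.1 hfix hY]
  exact Finset.sum_nonneg fun s _ => trace_mul_mul_conjTranspose_nonneg hρ _

theorem intertwines_of_trace_eq {A B : Fin d → Matrix (Fin D) (Fin D) ℂ}
    {ρ Y Z : Matrix (Fin D) (Fin D) ℂ} (hB : IsLeftCanonical B) (hρ : ρ.PosDef)
    (hfix : transferMap A ρ = ρ) (hY : mixedMap B A (Z * ρ) = Y * ρ)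
    (heq : (Z * ρ * Zᴴ).trace = (Y * ρ * Yᴴ).trace) (s : Fin d) : B s * Z = Y * A s := by
  have h := trace_sum_intertwining_defect hB hρ.1 hfix hY
  rw [heq, sub_self, Finset.sum_eq_zero_iff_of_nonneg
    fun s _ => trace_mul_mul_conjTranspose_nonneg hρ _] at h
  exact sub_eq_zero.1 (trace_mul_mul_conjTranspose_eq_zero hρ (h s (Finset.mem_univ s)))

/-! ### Overlaps of matrix product states -/

/-- The tensor `A` with an operator applied to its physical leg. -/
noncomputable def siteAct (W : Matrix (Fin d) (Fin d) ℂ) (A : Fin d → Matrix (Fin D) (Fin D) ℂ) :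
    Fin d → Matrix (Fin D) (Fin D) ℂ :=
  fun s => ∑ s', W s s' • A s'

theorem siteAct_siteAct (V W : Matrix (Fin d) (Fin d) ℂ) (A : Fin d → Matrix (Fin D) (Fin D) ℂ) :
    siteAct V (siteAct W A) = siteAct (V * W) A := by
  ext1 s
  simp only [siteAct, Matrix.mul_apply, Finset.smul_sum, Finset.sum_smul, smul_smul]
  exact Finset.sum_comm

theorem siteAct_smul (c : ℂ) (W : Matrix (Fin d) (Fin d) ℂ)
    (A : Fin d → Matrix (Fin D) (Fin D) ℂ) (s : Fin d) :
    siteAct (c • W) A s = c • siteAct W A s := by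
  simp [siteAct, Finset.smul_sum, smul_smul]

theorem siteAct_mul_mul (W : Matrix (Fin d) (Fin d) ℂ) (A : Fin d → Matrix (Fin D) (Fin D) ℂ)
    (P Q : Matrix (Fin D) (Fin D) ℂ) (s : Fin d) :
    siteAct W (fun s => P * A s * Q) s = P * siteAct W A s * Q := by
  simp [siteAct, Finset.mul_sum, Finset.sum_mul]

theorem siteAct_smul_right (c : ℂ) (W : Matrix (Fin d) (Fin d) ℂ)
    (A : Fin d → Matrix (Fin D) (Fin D) ℂ) (s : Fin d) :
    siteAct W (fun s => c • A s) s = c • siteAct W A s := by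
  simp [siteAct, Finset.smul_sum, smul_comm c]

theorem IsLeftCanonical.siteAct {A : Fin d → Matrix (Fin D) (Fin D) ℂ} (hA : IsLeftCanonical A)
    {W : Matrix (Fin d) (Fin d) ℂ} (hW : Wᴴ * W = 1) : IsLeftCanonical (siteAct W A) := by
  have hW' : ∀ a b, ∑ s, star (W s a) * W s b = (1 : Matrix (Fin d) (Fin d) ℂ) a b := by
    intro a b
    rw [← hW, Matrix.mul_apply]
    rfl
  have : ∑ s, (ModulatedMPS.siteAct W A s)ᴴ * ModulatedMPS.siteAct W A s =
      ∑ a, ∑ b, (∑ s, star (W s a) * W s b) • ((A a)ᴴ * A b) := by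
    simp only [ModulatedMPS.siteAct, Matrix.conjTranspose_sum, Matrix.conjTranspose_smul,
      Matrix.sum_mul, Matrix.mul_sum, Finset.sum_smul, Matrix.smul_mul, Matrix.mul_smul]
    rw [Finset.sum_comm]
    conv_rhs => rw [Finset.sum_comm]
    refine Finset.sum_congr rfl fun b _ => ?_
    simp only [Finset.smul_sum, smul_smul]
    rw [Finset.sum_comm]
    simp only [mul_comm]
  rw [IsLeftCanonical, this]
  simp only [hW', Matrix.one_apply, ite_smul, one_smul, zero_smul, Finset.sum_ite_eq,
    Finset.mem_univ, if_true]
  exact hA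

theorem prod_ofFn_sum {R : Type*} [Semiring R] {N : ℕ} (F : Fin N → Fin d → R) :
    (List.ofFn fun i => ∑ t, F i t).prod =
      ∑ t : Fin N → Fin d, (List.ofFn fun i => F i (t i)).prod := by
  induction N with
  | zero => simp
  | succ N ih =>
    rw [List.ofFn_succ, List.prod_cons, ih, Finset.sum_mul_sum, ← Fintype.sum_prod_type',
      ← (Fin.consEquiv fun _ => Fin d).sum_comp]
    refine Finset.sum_congr rfl fun x _ => ?_
    simp [List.ofFn_succ, Fin.consEquiv]

theorem prod_ofFn_smul {R : Type*} [Ring R] [Algebra ℂ R] {N : ℕ} (c : Fin N → ℂ) (F : Fin N → R) :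
    (List.ofFn fun i => c i • F i).prod = (∏ i, c i) • (List.ofFn F).prod := by
  induction N with
  | zero => simp
  | succ N ih =>
    rw [List.ofFn_succ, List.prod_cons, ih, Fin.prod_univ_succ, List.ofFn_succ, List.prod_cons,
      smul_mul_smul_comm]

theorem prod_ofFn_mulLeft_mulRight {N : ℕ} (P Q : Fin N → Matrix (Fin D) (Fin D) ℂ) :
    (List.ofFn fun i => (LinearMap.mulLeft ℂ (P i) ∘ₗ LinearMap.mulRight ℂ (Q i)ᴴ :
        Module.End ℂ (Matrix (Fin D) (Fin D) ℂ))).prod =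
      LinearMap.mulLeft ℂ (List.ofFn P).prod ∘ₗ LinearMap.mulRight ℂ ((List.ofFn Q).prod)ᴴ := by
  induction N with
  | zero => ext1 X; simp
  | succ N ih =>
    rw [List.ofFn_succ, List.prod_cons, ih]
    ext1 X
    simp [List.ofFn_succ, Matrix.mul_assoc]

theorem trace_mulLeft_comp_mulRight (P Q : Matrix (Fin D) (Fin D) ℂ) :
    LinearMap.trace ℂ (Matrix (Fin D) (Fin D) ℂ) (LinearMap.mulLeft ℂ P ∘ₗ LinearMap.mulRight ℂ Q)
      = P.trace * Q.trace := by
  rw [LinearMap.trace_eq_matrix_trace ℂ (Matrix.stdBasis ℂ (Fin D) (Fin D)), Matrix.trace,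
    Fintype.sum_prod_type, Matrix.trace, Matrix.trace, Finset.sum_mul_sum]
  refine Finset.sum_congr rfl fun i _ => Finset.sum_congr rfl fun j _ => ?_
  rw [Matrix.diag_apply, LinearMap.toMatrix_apply, Matrix.stdBasis_eq_single]
  have : ∀ X : Matrix (Fin D) (Fin D) ℂ,
      (Matrix.stdBasis ℂ (Fin D) (Fin D)).repr X (i, j) = X i j := fun X => by
    simp [Matrix.stdBasis]
  rw [this]
  simp [Matrix.mul_apply, Matrix.single_apply, Finset.sum_ite_eq, ite_and]

theorem tensorOp_mulVec_mpsState {N : ℕ} (W : Fin N → Matrix (Fin d) (Fin d) ℂ)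
    (A : Fin d → Matrix (Fin D) (Fin D) ℂ) (s : Fin N → Fin d) :
    (tensorOp W *ᵥ mpsState A N) s = ((List.ofFn fun i => siteAct (W i) A (s i)).prod).trace := by
  simp only [siteAct]
  rw [prod_ofFn_sum fun i t => W i (s i) t • A t, Matrix.trace_sum]
  simp only [prod_ofFn_smul, Matrix.trace_smul]
  rfl

/-- The overlap of two periodic states is a trace of mixed maps, because `X ↦ P X Q` has trace `tr P
· tr Q`. -/
theorem trace_prod_mixedMap {N : ℕ} (B : Fin N → Fin d → Matrix (Fin D) (Fin D) ℂ)
    (A : Fin d → Matrix (Fin D) (Fin D) ℂ) :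
    LinearMap.trace ℂ _ (List.ofFn fun i => mixedMap (B i) A).prod =
      ∑ s : Fin N → Fin d, ((List.ofFn fun i => B i (s i)).prod).trace * star (mpsState A N s) := by
  simp only [mixedMap]
  rw [prod_ofFn_sum, map_sum]
  refine Finset.sum_congr rfl fun s _ => ?_
  rw [prod_ofFn_mulLeft_mulRight, trace_mulLeft_comp_mulRight, Matrix.trace_conjTranspose]
  rfl

theorem prod_ofFn_mul_cast {R : Type*} [Monoid R] {L : ℕ} (f : ZMod L → R) (k : ℕ) :
    (List.ofFn fun i : Fin (k * L) => f ((i : ℕ) : ZMod L)).prod =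
      ((List.range L).map fun m : ℕ => f (m : ZMod L)).prod ^ k := by
  rw [List.ofFn_mul]
  have : ∀ i : Fin k, (List.ofFn fun j : Fin L => f (((i * L + j : ℕ)) : ZMod L)) =
      (List.range L).map fun m : ℕ => f (m : ZMod L) := by
    intro i
    simp [← List.map_coe_finRange_eq_range, List.ofFn_eq_map]
  simp only [this]
  rw [List.ofFn_const, List.prod_flatten, List.map_replicate, List.prod_replicate]

theorem trace_prod_mixedMap_siteAct_pow {L : ℕ} {V : ZMod L → Matrix (Fin d) (Fin d) ℂ}
    {A : Fin d → Matrix (Fin D) (Fin D) ℂ} {k : ℕ} {θ : ℂ}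
    (h : tensorOp (fun i : Fin (k * L) => V ((i : ℕ) : ZMod L)) *ᵥ mpsState A (k * L) =
      θ • mpsState A (k * L)) :
    LinearMap.trace ℂ _
        (((List.range L).map fun m : ℕ => mixedMap (siteAct (V (m : ZMod L)) A) A).prod ^ k) =
      θ * LinearMap.trace ℂ _ (transferMap A ^ (k * L)) := by
  have h1 : transferMap A ^ (k * L) = (List.ofFn fun _ : Fin (k * L) => mixedMap A A).prod := by
    rw [List.ofFn_const, List.prod_replicate]
    rfl
  rw [h1, ← prod_ofFn_mul_cast fun j => mixedMap (siteAct (V j) A) A, trace_prod_mixedMap,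
    trace_prod_mixedMap, Finset.mul_sum]
  refine Finset.sum_congr rfl fun s _ => ?_
  rw [← tensorOp_mulVec_mpsState (fun i => V ((i : ℕ) : ZMod L)), h, Pi.smul_apply, smul_eq_mul,
    mul_assoc]
  rfl

/-- If the periodic states are eigenstates of an on-site operator with eigenvalues of modulus one,
the mixed transfer map around a unit cell has an eigenvalue of modulus at least one. -/
theorem exists_hasEigenvector_prod_mixedMap {L : ℕ} (hL : 0 < L)
    {V : ZMod L → Matrix (Fin d) (Fin d) ℂ} {A : Fin d → Matrix (Fin D) (Fin D) ℂ}
    {ρ : Matrix (Fin D) (Fin D) ℂ} (hc : IsLeftCanonical A) (hρ : IsDominantState A ρ)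
    (h : ∀ k : ℕ, 0 < k → ∃ θ : Circle,
      tensorOp (fun i : Fin (k * L) => V ((i : ℕ) : ZMod L)) *ᵥ mpsState A (k * L) =
        (θ : ℂ) • mpsState A (k * L)) :
    ∃ μ X, Module.End.HasEigenvector
      ((List.range L).map fun m : ℕ => mixedMap (siteAct (V (m : ZMod L)) A) A).prod μ X ∧
      1 ≤ ‖μ‖ := by
  by_contra! hlt
  -- Were all eigenvalues inside the open disc, these traces would tend to 0; symmetry makes their
  -- moduli tend to 1.
  have h0 := (tendsto_pow_end_of_forall_hasEigenvector _ hlt (LinearMap.trace ℂ _)).norm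
  have h1 := ((hρ.tendsto_trace_pow hc).comp (tendsto_id.atTop_mul_const' hL)).norm
  have h2 := h1.congr' (f₂ := fun k => ‖LinearMap.trace ℂ _
      (((List.range L).map fun m : ℕ => mixedMap (siteAct (V (m : ZMod L)) A) A).prod ^ k)‖) (by
    filter_upwards [eventually_gt_atTop 0] with k hk
    obtain ⟨θ, hθ⟩ := h k hk
    rw [trace_prod_mixedMap_siteAct_pow hθ, norm_mul, Circle.norm_coe, one_mul]
    rfl)
  simpa using tendsto_nhds_unique h0 h2

/-! ### Existence of the bond unitaries -/

theorem exists_unitary_pushThrough (hL : 0 < L)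
    {V : ZMod L → Matrix (Fin d) (Fin d) ℂ} (hV : ∀ j, (V j)ᴴ * V j = 1)
    {A : Fin d → Matrix (Fin D) (Fin D) ℂ}
    {ρ : Matrix (Fin D) (Fin D) ℂ} (hc : IsLeftCanonical A) (hρ : IsDominantState A ρ)
    (h : ∀ k : ℕ, 0 < k → ∃ θ : Circle,
      tensorOp (fun i : Fin (k * L) => V ((i : ℕ) : ZMod L)) *ᵥ mpsState A (k * L) =
        (θ : ℂ) • mpsState A (k * L)) :
    ∃ v : ZMod L → Matrix.unitaryGroup (Fin D) ℂ, ∀ j, ∃ c : Circle, ∀ s, siteAct (V j) A s =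
      (c : ℂ) • ((v (j - 1) : Matrix (Fin D) (Fin D) ℂ)ᴴ * A s *
        (v j : Matrix (Fin D) (Fin D) ℂ)) := by
  have : NeZero L := ⟨hL.ne'⟩
  obtain ⟨μ, X, hX, hμ⟩ := exists_hasEigenvector_prod_mixedMap hL hc hρ h
  set B : ℕ → Fin d → Matrix (Fin D) (Fin D) ℂ := fun m => siteAct (V (m : ZMod L)) A with hBdef
  have hB : ∀ m, IsLeftCanonical (B m) := fun m => hc.siteAct (hV _)
  set l := (List.range L).map fun m : ℕ => mixedMap (B m) A with hl
  have hlen : l.length = L := by simp [hl]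
  have hρu : IsUnit ρ.det := (Matrix.isUnit_iff_isUnit_det _).1 hρ.posDef.isUnit
  -- `z m` is the eigenvector transported through sites `L - 1, …, m`, with `ρ` divided off so that
  -- the weighted norm applies.
  let z : ℕ → Matrix (Fin D) (Fin D) ℂ := fun m => (l.drop m).prod X * ρ⁻¹
  have hzρ : ∀ m, z m * ρ = (l.drop m).prod X := fun m => Matrix.nonsing_inv_mul_cancel_right _ _ hρu
  have hz0 : z 0 = μ • z L := by
    have h1 : (l.drop 0).prod X = μ • X := hX.apply_eq_smul
    have h2 : (l.drop L).prod X = X := by rw [← hlen, List.drop_length]; rfl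
    simp only [z]
    rw [h1, h2, Matrix.smul_mul]
  have hstep : ∀ m < L, mixedMap (B m) A (z (m + 1) * ρ) = z m * ρ := by
    intro m hm
    rw [hzρ, hzρ, List.drop_eq_getElem_cons (i := m) (by rwa [hlen]), List.prod_cons,
      Module.End.mul_apply]
    simp [hl]
  have hzL : z L ≠ 0 := by
    intro h0
    have h2 : (l.drop L).prod X = X := by rw [← hlen, List.drop_length]; rfl
    have h3 := hzρ L
    rw [h0, h2, zero_mul] at h3
    exact hX.2 h3.symm
  have hle : ∀ m < L, (z m * ρ * (z m)ᴴ).trace ≤ (z (m + 1) * ρ * (z (m + 1))ᴴ).trace :=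
    fun m hm => trace_mixedMap_le (hB m) hρ.posDef hρ.fixed (hstep m hm)
  have hlow : ∀ m ≤ L, (z 0 * ρ * (z 0)ᴴ).trace ≤ (z m * ρ * (z m)ᴴ).trace := by
    intro m
    induction m with
    | zero => exact fun _ => le_rfl
    | succ m ih => exact fun hm => (ih (by omega)).trans (hle m (by omega))
  have hhigh : ∀ n ≤ L, (z (L - n) * ρ * (z (L - n))ᴴ).trace ≤ (z L * ρ * (z L)ᴴ).trace := by
    intro n
    induction n with
    | zero => exact fun _ => le_rfl
    | succ n ih =>
      intro hn
      refine le_trans ?_ (ih (by omega))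
      have := hle (L - (n + 1)) (by omega)
      rwa [show L - (n + 1) + 1 = L - n by omega] at this
  have hpos : 0 < (z L * ρ * (z L)ᴴ).trace :=
    (trace_mul_mul_conjTranspose_nonneg hρ.posDef _).lt_of_ne
      fun h0 => hzL (trace_mul_mul_conjTranspose_eq_zero hρ.posDef h0.symm)
  have hwrap : (z 0 * ρ * (z 0)ᴴ).trace = ((‖μ‖ ^ 2 : ℝ) : ℂ) * (z L * ρ * (z L)ᴴ).trace := by
    rw [hz0, Matrix.conjTranspose_smul]
    simp only [Matrix.smul_mul, Matrix.mul_smul, Matrix.trace_smul, smul_eq_mul]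
    rw [← mul_assoc]
    congr 1
    rw [Complex.ofReal_pow]
    exact Complex.conj_mul' μ
  -- Since `‖μ‖ ≥ 1`, the chain of inequalities closes around the cell and all norms coincide.
  have hge : (z L * ρ * (z L)ᴴ).trace ≤ (z 0 * ρ * (z 0)ᴴ).trace := by
    rw [hwrap]
    refine le_mul_of_one_le_left hpos.le ?_
    exact_mod_cast one_le_pow₀ hμ
  have heq0 : (z 0 * ρ * (z 0)ᴴ).trace = (z L * ρ * (z L)ᴴ).trace :=
    le_antisymm (hlow L le_rfl) hge
  have heq : ∀ m ≤ L, (z m * ρ * (z m)ᴴ).trace = (z L * ρ * (z L)ᴴ).trace := by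
    intro m hm
    refine le_antisymm ?_ (hge.trans (hlow m hm))
    have := hhigh (L - m) (by omega)
    rwa [show L - (L - m) = m by omega] at this
  have hμ1 : ‖μ‖ = 1 := by
    rw [hwrap] at heq0
    have h1 := mul_right_cancel₀ hpos.ne' (heq0.trans (one_mul _).symm)
    have h2 : ‖μ‖ ^ 2 = 1 := by exact_mod_cast h1
    exact (pow_eq_one_iff_of_nonneg (norm_nonneg _) two_ne_zero).1 h2
  have hint : ∀ m < L, ∀ s, B m s * z (m + 1) = z m * A s := fun m hm =>
    intertwines_of_trace_eq (hB m) hρ.posDef hρ.fixed (hstep m hm)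
      ((heq (m + 1) hm).trans (heq m hm.le).symm)
  -- The dual transfer map advances the Gram matrices; as `‖μ‖ = 1`, a full cell fixes `(z 0)ᴴ * z
  -- 0`, which is thus scalar.
  have hgram : ∀ m < L, ∑ s, (A s)ᴴ * ((z m)ᴴ * z m) * A s = (z (m + 1))ᴴ * z (m + 1) := by
    intro m hm
    have h1 : ∀ s, (A s)ᴴ * ((z m)ᴴ * z m) * A s =
        (z (m + 1))ᴴ * ((B m s)ᴴ * B m s) * z (m + 1) := by
      intro s
      rw [← Matrix.mul_assoc, ← Matrix.conjTranspose_mul, Matrix.mul_assoc, ← hint m hm s,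
        Matrix.conjTranspose_mul]
      simp only [Matrix.mul_assoc]
    simp_rw [h1]
    rw [← Finset.sum_mul, ← Finset.mul_sum, hB m, Matrix.mul_one]
  have hiter : ∀ n ≤ L, (fun Y => ∑ s, (A s)ᴴ * Y * A s)^[n] ((z 0)ᴴ * z 0) = (z n)ᴴ * z n := by
    intro n
    induction n with
    | zero => exact fun _ => rfl
    | succ n ih =>
      intro hn
      rw [Function.iterate_succ_apply', ih (by omega), hgram n hn]
  have hK0 : (z 0)ᴴ * z 0 = (z L)ᴴ * z L := by
    have hμμ : star μ * μ = 1 := by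
      have := Complex.conj_mul' μ
      rw [hμ1] at this
      simpa using this
    rw [hz0, Matrix.conjTranspose_smul, Matrix.smul_mul, Matrix.mul_smul, smul_smul, hμμ, one_smul]
  have hscal := hρ.eq_smul_one_of_iterate_dual hc hL ((hiter L le_rfl).trans hK0.symm)
  obtain ⟨t, ht0, htr⟩ : ∃ t : ℝ, 0 < t ∧ ((z 0)ᴴ * z 0 * ρ).trace = t := by
    have h1 : ((z 0)ᴴ * z 0 * ρ).trace = (z 0 * ρ * (z 0)ᴴ).trace := by
      rw [Matrix.mul_assoc, Matrix.trace_mul_comm]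
    rw [← heq0, ← h1, Complex.pos_iff] at hpos
    exact ⟨_, hpos.1, Complex.ext rfl (by simpa using hpos.2.symm)⟩
  rw [htr] at hscal
  have hK : ∀ n ≤ L, (z n)ᴴ * z n = (t : ℂ) • (1 : Matrix (Fin D) (Fin D) ℂ) := by
    intro n
    induction n with
    | zero => exact fun _ => hscal
    | succ n ih =>
      intro hn
      rw [← hgram n hn, ih (by omega)]
      simp only [Matrix.mul_smul, Matrix.smul_mul, Matrix.mul_one, ← Finset.smul_sum]
      rw [hc]
  let w : ℕ → Matrix (Fin D) (Fin D) ℂ := fun n => (((√t)⁻¹ : ℝ) : ℂ) • z n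
  have hw : ∀ n ≤ L, (w n)ᴴ * w n = 1 := by
    intro n hn
    simp only [w, Matrix.conjTranspose_smul, Matrix.smul_mul, Matrix.mul_smul, smul_smul, hK n hn]
    have : (√t)⁻¹ * (√t)⁻¹ * t = 1 := by
      rw [← mul_inv, Real.mul_self_sqrt ht0.le, inv_mul_cancel₀ ht0.ne']
    have h2 : star (((√t)⁻¹ : ℝ) : ℂ) = (((√t)⁻¹ : ℝ) : ℂ) := Complex.conj_ofReal _
    rw [h2, ← Complex.ofReal_mul, ← Complex.ofReal_mul, ← mul_assoc, this]
    simp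
  have hwint : ∀ m < L, ∀ s, B m s = w m * A s * (w (m + 1))ᴴ := by
    intro m hm s
    have h1 : B m s * w (m + 1) = w m * A s := by
      simp only [w, Matrix.mul_smul, Matrix.smul_mul, hint m hm s]
    rw [← h1, Matrix.mul_assoc, mul_eq_one_comm.1 (hw (m + 1) hm), Matrix.mul_one]
  have hval : ∀ j : ZMod L, j.val + 1 ≤ L := fun j => ZMod.val_lt j
  -- Bond `j` lies to the right of site `j`, hence the shift. Only site 0 wraps around, so it alone
  -- carries the phase `μ`, from `w 0 = μ • w L`.
  refine ⟨fun j => ⟨(w (j.val + 1))ᴴ, Matrix.mem_unitaryGroup_iff.2 ?_⟩, fun j => ?_⟩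
  · rw [Matrix.star_eq_conjTranspose, Matrix.conjTranspose_conjTranspose]
    exact hw _ (hval j)
  · have hj : siteAct (V j) A = B j.val := by
      simp only [hBdef, ZMod.natCast_zmod_val]
    rw [hj]
    obtain ⟨m, hm⟩ : ∃ m, j.val = m := ⟨_, rfl⟩
    have hmL : m < L := hm ▸ ZMod.val_lt j
    have hjm : j = (m : ZMod L) := by rw [← hm, ZMod.natCast_zmod_val]
    cases m with
    | zero =>
      have hj1 : (j - 1).val + 1 = L := by
        have : j - 1 = ((L - 1 : ℕ) : ZMod L) := by
          rw [hjm, Nat.cast_sub hL]; simp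
        rw [this, ZMod.val_natCast_of_lt (by omega)]
        omega
      refine ⟨⟨μ, mem_sphere_zero_iff_norm.2 hμ1⟩, fun s => ?_⟩
      simp only [hj1, hm, Matrix.conjTranspose_conjTranspose]
      have hw0 : w 0 = μ • w L := by simp only [w, hz0, smul_comm μ]
      rw [hwint 0 hmL, hw0, Matrix.smul_mul, Matrix.smul_mul]
    | succ m =>
      have hj1 : (j - 1).val + 1 = m + 1 := by
        have : j - 1 = ((m : ℕ) : ZMod L) := by
          rw [hjm]; simp
        rw [this, ZMod.val_natCast_of_lt (by omega)]
      refine ⟨1, fun s => ?_⟩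
      simp only [hj1, hm, Matrix.conjTranspose_conjTranspose]
      rw [hwint _ hmL, Circle.coe_one, one_smul]

/-! ### Rigidity of the bond unitaries -/

/-- The transfer map sends `W j * ρ` to a phase times `W (j - 1) * ρ`. After `L` steps it returns to
itself up to a phase, so it is a multiple of `ρ`. -/
theorem exists_eq_smul_one_of_intertwines (hL : 0 < L) {A : Fin d → Matrix (Fin D) (Fin D) ℂ}
    {ρ : Matrix (Fin D) (Fin D) ℂ} (hc : IsLeftCanonical A) (hρ : IsDominantState A ρ)
    {W : ZMod L → Matrix (Fin D) (Fin D) ℂ} {c : ZMod L → Circle}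
    (hW : ∀ j s, A s * W j = (c j : ℂ) • (W (j - 1) * A s)) (j : ZMod L) :
    ∃ w : ℂ, W j = w • 1 := by
  have hE : ∀ j, transferMap A (W j * ρ) = (c j : ℂ) • (W (j - 1) * ρ) := by
    intro j
    rw [transferMap_apply]
    have : ∀ s, A s * (W j * ρ) * (A s)ᴴ = (c j : ℂ) • (W (j - 1) * (A s * ρ * (A s)ᴴ)) := by
      intro s
      rw [← Matrix.mul_assoc, hW]
      simp only [Matrix.smul_mul, Matrix.mul_assoc]
    simp_rw [this]
    rw [← Finset.smul_sum, ← Finset.mul_sum, ← transferMap_apply, hρ.fixed]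
  have hpow : ∀ n : ℕ, ∀ j, ∃ C : Circle, (transferMap A ^ n) (W j * ρ) =
      (C : ℂ) • (W (j - n) * ρ) := by
    intro n
    induction n with
    | zero => exact fun j => ⟨1, by simp⟩
    | succ n ih =>
      intro j
      obtain ⟨C, hC⟩ := ih (j - 1)
      refine ⟨c j * C, ?_⟩
      rw [pow_succ, Module.End.mul_apply, hE, map_smul, hC, smul_smul, Circle.coe_mul]
      rw [Nat.cast_succ, sub_sub, add_comm (1 : ZMod L)]
  obtain ⟨C, hC⟩ := hpow L j
  rw [ZMod.natCast_self, sub_zero] at hC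
  have h1 := hρ.eq_smul_of_pow_apply hc hL (Circle.norm_coe C) hC
  have hρu : IsUnit ρ.det := (Matrix.isUnit_iff_isUnit_det _).1 hρ.posDef.isUnit
  refine ⟨(W j * ρ).trace, ?_⟩
  calc W j = W j * ρ * ρ⁻¹ := (Matrix.mul_nonsing_inv_cancel_right _ _ hρu).symm
    _ = _ := by
      conv_lhs => rw [h1]
      rw [Matrix.smul_mul, Matrix.mul_nonsing_inv _ hρu]

theorem coe_unitaryGroup_ne_zero (hD : 0 < D) (V : Matrix.unitaryGroup (Fin D) ℂ) :
    (V : Matrix (Fin D) (Fin D) ℂ) ≠ 0 := by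
  have : Nonempty (Fin D) := ⟨⟨0, hD⟩⟩
  intro h
  have := Matrix.UnitaryGroup.star_mul_self V
  rw [h, Matrix.mul_zero] at this
  exact zero_ne_one this

theorem circle_eq_of_smul_eq {M : Type*} [AddCommGroup M] [Module ℂ M] {X : M} (hX : X ≠ 0)
    {a b : Circle} (h : (a : ℂ) • X = (b : ℂ) • X) : a = b :=
  Circle.ext (smul_left_injective ℂ hX h)

theorem conjTranspose_mul_coe (V : Matrix.unitaryGroup (Fin D) ℂ) :
    (V : Matrix (Fin D) (Fin D) ℂ)ᴴ * (V : Matrix (Fin D) (Fin D) ℂ) = 1 :=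
  Matrix.UnitaryGroup.star_mul_self V

theorem coe_mul_conjTranspose (V : Matrix.unitaryGroup (Fin D) ℂ) :
    (V : Matrix (Fin D) (Fin D) ℂ) * (V : Matrix (Fin D) (Fin D) ℂ)ᴴ = 1 :=
  Matrix.mem_unitaryGroup_iff.1 V.2

theorem exists_circle_eq_smul (hD : 0 < D) {P Q : Matrix.unitaryGroup (Fin D) ℂ} {w : ℂ}
    (h : (P : Matrix (Fin D) (Fin D) ℂ) * (Q : Matrix (Fin D) (Fin D) ℂ)ᴴ = w • 1) :
    ∃ a : Circle, (P : Matrix (Fin D) (Fin D) ℂ) = (a : ℂ) • (Q : Matrix (Fin D) (Fin D) ℂ) := by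
  have : Nonempty (Fin D) := ⟨⟨0, hD⟩⟩
  have hPQ : (P : Matrix (Fin D) (Fin D) ℂ) = w • (Q : Matrix (Fin D) (Fin D) ℂ) := by
    rw [← Matrix.mul_one (P : Matrix (Fin D) (Fin D) ℂ), ← conjTranspose_mul_coe Q,
      ← Matrix.mul_assoc, h, Matrix.smul_mul, Matrix.one_mul]
  have hw : ‖w‖ = 1 := by
    have h1 := conjTranspose_mul_coe P
    rw [hPQ, Matrix.conjTranspose_smul, Matrix.smul_mul, Matrix.mul_smul, smul_smul,
      conjTranspose_mul_coe] at h1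
    have h2 : star w * w = 1 := by
      have := congrFun (congrFun h1 ⟨0, hD⟩) ⟨0, hD⟩
      simpa using this
    have h3 := Complex.conj_mul' w
    have h4 : ((‖w‖ ^ 2 : ℝ) : ℂ) = 1 := by
      push_cast
      exact h3.symm.trans h2
    exact (pow_eq_one_iff_of_nonneg (norm_nonneg _) two_ne_zero).1 (by exact_mod_cast h4)
  exact ⟨⟨w, mem_sphere_zero_iff_norm.2 hw⟩, hPQ⟩

/-- Two families of bond unitaries acting on the tensor in the same way up to phases agree up to
phases. -/
theorem exists_phases_of_conj_eq (hL : 0 < L) (hD : 0 < D)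
    {A : Fin d → Matrix (Fin D) (Fin D) ℂ}
    {ρ : Matrix (Fin D) (Fin D) ℂ} (hc : IsLeftCanonical A) (hρ : IsDominantState A ρ)
    {v v' : ZMod L → Matrix.unitaryGroup (Fin D) ℂ} {c : ZMod L → Circle}
    (h : ∀ j s, (v (j - 1) : Matrix (Fin D) (Fin D) ℂ)ᴴ * A s * (v j : Matrix (Fin D) (Fin D) ℂ) =
      (c j : ℂ) • ((v' (j - 1) : Matrix (Fin D) (Fin D) ℂ)ᴴ * A s *
        (v' j : Matrix (Fin D) (Fin D) ℂ))) :
    ∃ w : ZMod L → Circle, ∀ j, (v j : Matrix (Fin D) (Fin D) ℂ) =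
      (w j : ℂ) • (v' j : Matrix (Fin D) (Fin D) ℂ) ∧ w j = c j * w (j - 1) := by
  have : Nonempty (Fin D) := ⟨⟨0, hD⟩⟩
  have hW : ∀ j, ∃ a : Circle, (v j : Matrix (Fin D) (Fin D) ℂ) =
      (a : ℂ) • (v' j : Matrix (Fin D) (Fin D) ℂ) := by
    intro j
    obtain ⟨w, hw⟩ := exists_eq_smul_one_of_intertwines hL hc hρ
      (W := fun j => (v j : Matrix (Fin D) (Fin D) ℂ) * (v' j : Matrix (Fin D) (Fin D) ℂ)ᴴ)
      (c := c) (fun j s => by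
        have h1 := congrArg (fun M => (v (j - 1) : Matrix (Fin D) (Fin D) ℂ) * M *
          (v' j : Matrix (Fin D) (Fin D) ℂ)ᴴ) (h j s)
        simp only [Matrix.mul_smul, Matrix.smul_mul, Matrix.mul_assoc, coe_mul_conjTranspose,
          Matrix.mul_one] at h1
        rw [← Matrix.mul_assoc, coe_mul_conjTranspose, Matrix.one_mul] at h1
        rw [h1]
        simp only [Matrix.mul_assoc]) j
    exact exists_circle_eq_smul hD hw
  choose w hw using hW
  refine ⟨w, fun j => ⟨hw j, ?_⟩⟩
  -- A nonzero matrix is needed to cancel in the push-through relation and read off the recursion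
  -- for the phases.
  obtain ⟨s, hs⟩ : ∃ s, A s ≠ 0 := by
    by_contra! h0
    have : ∑ s, (A s)ᴴ * A s = 0 := Finset.sum_eq_zero fun s _ => by rw [h0 s, Matrix.mul_zero]
    exact zero_ne_one (this.symm.trans hc)
  have hne : (v' (j - 1) : Matrix (Fin D) (Fin D) ℂ)ᴴ * A s *
      (v' j : Matrix (Fin D) (Fin D) ℂ) ≠ 0 := by
    intro h0
    have h1 := congrArg (fun M => (v' (j - 1) : Matrix (Fin D) (Fin D) ℂ) * M *
          (v' j : Matrix (Fin D) (Fin D) ℂ)ᴴ) h0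
    simp only [Matrix.mul_assoc, coe_mul_conjTranspose, Matrix.mul_one, Matrix.zero_mul,
      Matrix.mul_zero] at h1
    rw [← Matrix.mul_assoc, coe_mul_conjTranspose, Matrix.one_mul] at h1
    exact hs h1
  have h1 := h j s
  rw [hw j, hw (j - 1), Matrix.conjTranspose_smul, Matrix.smul_mul, Matrix.smul_mul,
    Matrix.mul_smul, smul_smul] at h1
  have hstar : star (w (j - 1) : ℂ) = ((w (j - 1))⁻¹ : Circle) := (Circle.coe_inv_eq_conj _).symm
  rw [hstar, ← Circle.coe_mul] at h1
  rw [← circle_eq_of_smul_eq hne h1, mul_comm, mul_inv_cancel_left]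

theorem exists_pushThrough {G : Type*} (hL : 0 < L) (hD : 0 < D)
    {U : ZMod L → G → Matrix.unitaryGroup (Fin d) ℂ} {A : Fin d → Matrix (Fin D) (Fin D) ℂ}
    (hA : IsInjective A) (hc : IsLeftCanonical A) (hS : IsSymmetric U A) :
    ∃ v : ZMod L → G → Matrix.unitaryGroup (Fin D) ℂ, PushThrough U A v := by
  obtain ⟨ρ, hρ⟩ := exists_isDominantState hD hA hc
  have hex : ∀ g, ∃ w : ZMod L → Matrix.unitaryGroup (Fin D) ℂ, ∀ j, ∃ c : Circle, ∀ s,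
      siteAct (U j g : Matrix (Fin d) (Fin d) ℂ) A s =
        (c : ℂ) • ((w (j - 1) : Matrix (Fin D) (Fin D) ℂ)ᴴ * A s *
          (w j : Matrix (Fin D) (Fin D) ℂ)) := fun g =>
    exists_unitary_pushThrough hL (V := fun j => (U j g : Matrix (Fin d) (Fin d) ℂ))
      (fun j => conjTranspose_mul_coe (U j g)) hc hρ (hS g)
  choose v hv using hex
  exact ⟨fun j g => v g j, fun j g => hv g j⟩

/-! ### Left-canonical gauge -/

theorem exists_conjTranspose_mul_self_eq {Λ : Matrix (Fin D) (Fin D) ℂ} (h : Λ.PosDef) :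
    ∃ K : Matrix (Fin D) (Fin D) ℂ, IsUnit K.det ∧ Λ = Kᴴ * K := by
  open scoped MatrixOrder in
  obtain ⟨K, hK⟩ := CStarAlgebra.nonneg_iff_eq_star_mul_self.mp h.posSemidef.nonneg
  rw [Matrix.star_eq_conjTranspose] at hK
  refine ⟨K, ?_, hK⟩
  have h1 := (Matrix.isUnit_iff_isUnit_det _).1 h.isUnit
  rw [hK, Matrix.det_mul] at h1
  exact isUnit_of_mul_isUnit_right h1

theorem mpsState_smul_conj {A : Fin d → Matrix (Fin D) (Fin D) ℂ} (a : ℂ)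
    {K : Matrix (Fin D) (Fin D) ℂ} (hK : IsUnit K.det) (N : ℕ) :
    mpsState (fun s => a • (K * A s * K⁻¹)) N = a ^ N • mpsState A N := by
  have hconj : ∀ (N : ℕ) (F : Fin N → Matrix (Fin D) (Fin D) ℂ),
      (List.ofFn fun i => K * F i * K⁻¹).prod = K * (List.ofFn F).prod * K⁻¹ := by
    intro N
    induction N with
    | zero => intro F; simp [Matrix.mul_nonsing_inv _ hK]
    | succ N ih =>
      intro F
      rw [List.ofFn_succ, List.prod_cons, ih, List.ofFn_succ, List.prod_cons]
      simp only [Matrix.mul_assoc, Matrix.nonsing_inv_mul_cancel_left _ _ hK]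
  ext s
  simp only [mpsState, Pi.smul_apply]
  rw [prod_ofFn_smul (fun _ => a), hconj N fun i => A (s i), Matrix.trace_smul,
    Matrix.trace_mul_comm, Matrix.nonsing_inv_mul_cancel_left _ _ hK]
  simp

/-- Writing `Λ = K† K`, the tensor `r^{-1/2} K A K⁻¹` is left-canonical. Its states are rescaled by
a constant, and its transfer map is `r⁻¹ E` conjugated by `X ↦ K X K†`. -/
theorem exists_leftCanonical {G : Type*} {U : ZMod L → G → Matrix.unitaryGroup (Fin d) ℂ}
    {A : Fin d → Matrix (Fin D) (Fin D) ℂ} (hA : IsInjective A) (hS : IsSymmetric U A) :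
    ∃ A' : Fin d → Matrix (Fin D) (Fin D) ℂ,
      IsInjective A' ∧ IsLeftCanonical A' ∧ IsSymmetric U A' := by
  obtain ⟨r, hr, ρ, Λ, hρ, hΛ, hfix, hdual, hdom⟩ := hA
  obtain ⟨K, hK, rfl⟩ := exists_conjTranspose_mul_self_eq hΛ
  have hK' : IsUnit Kᴴ.det := by rw [Matrix.det_conjTranspose]; exact hK.star
  have hrC : (r : ℂ) ≠ 0 := by exact_mod_cast hr.ne'
  set a : ℂ := (((√r)⁻¹ : ℝ) : ℂ) with ha
  have hstar : star a = a := Complex.conj_ofReal _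
  have haa : a * a = (r : ℂ)⁻¹ := by
    rw [ha, ← Complex.ofReal_mul, ← mul_inv, Real.mul_self_sqrt hr.le, Complex.ofReal_inv]
  set A' : Fin d → Matrix (Fin D) (Fin D) ℂ := fun s => a • (K * A s * K⁻¹) with hA'
  have hcanon : IsLeftCanonical A' := by
    have h1 : ∀ s, (A' s)ᴴ * A' s = (r : ℂ)⁻¹ • ((Kᴴ)⁻¹ * ((A s)ᴴ * (Kᴴ * K) * A s) * K⁻¹) := by
      intro s
      simp only [hA', Matrix.conjTranspose_smul, Matrix.smul_mul, Matrix.mul_smul, smul_smul, hstar,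
        haa, Matrix.conjTranspose_mul, Matrix.conjTranspose_nonsing_inv, Matrix.mul_assoc]
    rw [IsLeftCanonical]
    simp_rw [h1]
    rw [← Finset.smul_sum, ← Finset.sum_mul, ← Finset.mul_sum, hdual, Matrix.mul_smul,
      Matrix.smul_mul, smul_smul, inv_mul_cancel₀ hrC, one_smul,
      Matrix.nonsing_inv_mul_cancel_left _ _ hK', Matrix.mul_nonsing_inv _ hK]
  have htrans : ∀ X, transferMap A' (K * X * Kᴴ) = (r : ℂ)⁻¹ • (K * transferMap A X * Kᴴ) := by
    intro X
    rw [transferMap_apply, transferMap_apply, Finset.mul_sum, Finset.sum_mul, Finset.smul_sum]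
    refine Finset.sum_congr rfl fun s _ => ?_
    simp only [hA', Matrix.conjTranspose_smul, Matrix.smul_mul, Matrix.mul_smul, smul_smul, hstar,
        haa, Matrix.conjTranspose_mul, Matrix.conjTranspose_nonsing_inv, Matrix.mul_assoc,
        Matrix.nonsing_inv_mul_cancel_left _ _ hK, Matrix.mul_nonsing_inv_cancel_left _ _ hK']
  have hinv : ∀ X, K * (K⁻¹ * X * (Kᴴ)⁻¹) * Kᴴ = X := by
    intro X
    simp only [Matrix.mul_assoc, Matrix.mul_nonsing_inv_cancel_left _ _ hK,
      Matrix.nonsing_inv_mul _ hK', Matrix.mul_one]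
  refine ⟨A', ⟨1, one_pos, K * ρ * Kᴴ, 1, ?_, Matrix.PosDef.one, ?_, ?_, fun μ X hX => ?_⟩, hcanon,
    fun g k hk => ?_⟩
  · exact hρ.mul_mul_conjTranspose_same
      (Matrix.vecMul_injective_iff_isUnit.2 ((Matrix.isUnit_iff_isUnit_det _).2 hK))
  · rw [htrans, hfix, Matrix.mul_smul, Matrix.smul_mul, smul_smul, inv_mul_cancel₀ hrC]
    simp
  · simp only [Matrix.mul_one]
    rw [hcanon]
    simp
  · obtain ⟨Y, rfl⟩ : ∃ Y, X = K * Y * Kᴴ := ⟨_, (hinv X).symm⟩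
    have hY0 : Y ≠ 0 := by
      rintro rfl
      exact hX.2 (by simp)
    have hXe := hX.apply_eq_smul
    rw [htrans] at hXe
    have hYe : transferMap A Y = (r * μ) • Y := by
      have h1 := congrArg (fun M => (r : ℂ) • (K⁻¹ * M * (Kᴴ)⁻¹)) hXe
      simpa only [Matrix.mul_smul, Matrix.smul_mul, smul_smul, mul_inv_cancel₀ hrC, one_smul,
        Matrix.mul_assoc, Matrix.nonsing_inv_mul_cancel_left _ _ hK, Matrix.mul_nonsing_inv _ hK',
        Matrix.mul_one] using h1
    rcases hdom _ Y ⟨Module.End.mem_eigenspace_iff.2 hYe, hY0⟩ with ⟨h1, c, rfl⟩ | h1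
    · left
      refine ⟨?_, c, by rw [Matrix.mul_smul, Matrix.smul_mul]⟩
      have := mul_left_cancel₀ hrC (h1.trans (mul_one _).symm)
      simpa using this
    · right
      rw [norm_mul, Complex.norm_real, Real.norm_of_nonneg hr.le] at h1
      exact (mul_lt_iff_lt_one_right hr).1 h1
  · obtain ⟨θ, hθ⟩ := hS g k hk
    exact ⟨θ, by rw [mpsState_smul_conj a hK, Matrix.mulVec_smul, hθ, smul_comm]⟩

/-! ### Cocycles of projective representations -/

variable {G : Type*} [Group G]

/-- Associativity of the matrix product; positivity of `n` makes unitaries nonzero, so phases can be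
compared. -/
theorem IsProjectiveRep.isTwoCocycle {n : ℕ} (hn : 0 < n)
    {U : ZMod L → G → Matrix.unitaryGroup (Fin n) ℂ} {ν : ZMod L → G → G → Circle}
    (h : IsProjectiveRep U ν) (j : ZMod L) : IsTwoCocycle (ν j) := by
  intro g k l
  have h1 := h j g k
  have h2 := h j k l
  refine circle_eq_of_smul_eq (coe_unitaryGroup_ne_zero hn (U j (g * k * l))) ?_
  rw [Circle.coe_mul, Circle.coe_mul, mul_smul, mul_smul, ← h, ← Matrix.smul_mul, ← h1, mul_assoc,
    mul_assoc, ← h, h2, Matrix.mul_smul]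

theorem IsProjectiveRep.eqUpToCoboundary {n : ℕ} (hn : 0 < n) {T : MulAut G}
    {U : ZMod L → G → Matrix.unitaryGroup (Fin n) ℂ} {ν : ZMod L → G → G → Circle}
    (h : IsProjectiveRep U ν) (hU : IsCovariant T U) (j : ZMod L) :
    EqUpToCoboundary (ν j) (fun g h => ν (j - 1) (T g) (T h)) := by
  choose β hβ using hU j
  refine ⟨β, fun g k => ?_⟩
  have h1 := h j g k
  rw [hβ g, hβ k, hβ (g * k), smul_mul_smul_comm, h, map_mul, smul_smul, smul_smul,
    ← Circle.coe_mul, ← Circle.coe_mul, ← Circle.coe_mul] at h1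
  have h2 := circle_eq_of_smul_eq (coe_unitaryGroup_ne_zero hn _) h1
  rw [← mul_assoc, eq_mul_inv_iff_mul_eq, ← h2, mul_comm]

/-! ### Constraints on the bond cocycles -/

theorem PushThrough.isCovariant (hL : 0 < L) (hD : 0 < D) {T : MulAut G}
    {U : ZMod L → G → Matrix.unitaryGroup (Fin d) ℂ} (hU : IsCovariant T U)
    {A : Fin d → Matrix (Fin D) (Fin D) ℂ}
    {ρ : Matrix (Fin D) (Fin D) ℂ} (hc : IsLeftCanonical A) (hρ : IsDominantState A ρ)
    {v : ZMod L → G → Matrix.unitaryGroup (Fin D) ℂ} (hv : PushThrough U A v) :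
    IsCovariant T v := by
  choose c hcv using hv
  intro j g
  choose e he using fun j => hU j g
  -- `v (j - 1) (T g)` pushes `U (j - 1) (T g)` through, and this operator is `U j g` up to the
  -- phase `e j`.
  obtain ⟨w, hw⟩ := exists_phases_of_conj_eq hL hD hc hρ (v := fun j => v j g)
    (v' := fun j => v (j - 1) (T g)) (c := fun j => (c j g)⁻¹ * (e j * c (j - 1) (T g)))
    (fun j s => by
      have h1 := hcv j g s
      have h2 := hcv (j - 1) (T g) s
      have h3 := siteAct_smul (e j) (U (j - 1) (T g)) A s
      rw [← he j] at h3
      simp only [siteAct] at h3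
      rw [h1, h2, smul_smul] at h3
      rw [Circle.coe_mul, mul_smul, Circle.coe_mul, ← h3, smul_smul, ← Circle.coe_mul,
        inv_mul_cancel, Circle.coe_one, one_smul])
  exact ⟨w j, (hw j).1⟩

theorem PushThrough.exists_cocycle (hL : 0 < L) (hD : 0 < D)
    {U : ZMod L → G → Matrix.unitaryGroup (Fin d) ℂ} {ν : ZMod L → G → G → Circle}
    (hν : IsProjectiveRep U ν) {A : Fin d → Matrix (Fin D) (Fin D) ℂ}
    {ρ : Matrix (Fin D) (Fin D) ℂ} (hc : IsLeftCanonical A) (hρ : IsDominantState A ρ)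
    {v : ZMod L → G → Matrix.unitaryGroup (Fin D) ℂ} (hv : PushThrough U A v) :
    ∃ ω : ZMod L → G → G → Circle, IsProjectiveRep v ω ∧
      ∀ j, EqUpToCoboundary (ω j) (fun g h => ν j g h * ω (j - 1) g h) := by
  choose c hcv using hv
  have key : ∀ g h, ∃ w : ZMod L → Circle, ∀ j,
      (v j g * v j h : Matrix (Fin D) (Fin D) ℂ) =
        (w j : ℂ) • (v j (g * h) : Matrix (Fin D) (Fin D) ℂ) ∧
      w j = (c j g * c j h)⁻¹ * (ν j g h * c j (g * h)) * w (j - 1) := by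
    intro g h
    -- Acting with `U j g` after `U j h` puts `v j g` nearest to `A`, so the bond products appear in
    -- the order `g`, `h`. The phases `c` form a coboundary apart from `ν`.
    refine exists_phases_of_conj_eq hL hD hc hρ (v := fun j => v j g * v j h)
      (v' := fun j => v j (g * h)) (c := fun j => (c j g * c j h)⁻¹ * (ν j g h * c j (g * h)))
      (fun j s => ?_)
    have h1 : siteAct (U j h : Matrix (Fin d) (Fin d) ℂ) A = fun s => (c j h : ℂ) •
        ((v (j - 1) h : Matrix (Fin D) (Fin D) ℂ)ᴴ * A s * (v j h : Matrix (Fin D) (Fin D) ℂ)) :=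
      funext (hcv j h)
    have h2 := congrFun (siteAct_siteAct (U j g) (U j h) A) s
    rw [h1, hν, siteAct_smul, siteAct_smul_right, siteAct_mul_mul] at h2
    simp only [siteAct] at h2
    rw [hcv j g s, hcv j (g * h) s, smul_smul, Matrix.mul_smul, Matrix.smul_mul, smul_smul] at h2
    rw [Circle.coe_mul, mul_smul, Circle.coe_mul (ν j g h), ← h2, smul_smul, Circle.coe_inv,
      Circle.coe_mul, mul_comm (c j h : ℂ), inv_mul_cancel₀ (by simp), one_smul]
    simp [Matrix.conjTranspose_mul, Matrix.mul_assoc]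
  choose w hw using key
  refine ⟨fun j g h => w g h j, fun j g h => (hw g h j).1, fun j => ⟨fun g => (c j g)⁻¹,
    fun g h => ?_⟩⟩
  simp only
  rw [(hw g h j).2, inv_inv, mul_inv]
  ac_rfl

theorem PushThrough.constraints (hL : 0 < L) (hD : 0 < D) {T : MulAut G}
    {U : ZMod L → G → Matrix.unitaryGroup (Fin d) ℂ} {ν : ZMod L → G → G → Circle}
    (hν : IsProjectiveRep U ν) (hU : IsCovariant T U) {A : Fin d → Matrix (Fin D) (Fin D) ℂ}
    (hA : IsInjective A) (hc : IsLeftCanonical A)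
    {v : ZMod L → G → Matrix.unitaryGroup (Fin D) ℂ} (hv : PushThrough U A v) :
    IsCovariant T v ∧ ∃ ω : ZMod L → G → G → Circle, IsProjectiveRep v ω ∧
      (∀ j, IsTwoCocycle (ω j)) ∧ SatisfiesConstraints T ν ω := by
  obtain ⟨ρ, hρ⟩ := exists_isDominantState hD hA hc
  have hcov := hv.isCovariant hL hD hU hc hρ
  obtain ⟨ω, hω, hων⟩ := hv.exists_cocycle hL hD hν hc hρ
  exact ⟨hcov, ω, hω, hω.isTwoCocycle hD, fun j => ⟨hων j, hω.eqUpToCoboundary hD hcov j⟩⟩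

end ModulatedMPS

/-! ### Bond cocycles and the LSM-type obstruction -/

theorem mainTheorem3 {G : Type*} [Group G] (L : ℕ) (hL : 0 < L)
    (T : MulAut G) (hT : T ^ L = 1) (d : ℕ) (hd : 0 < d)
    (U : ZMod L → G → Matrix.unitaryGroup (Fin d) ℂ)
    (ν : ZMod L → G → G → Circle)
    (hν : ModulatedMPS.IsProjectiveRep U ν)
    (hU : ModulatedMPS.IsCovariant T U) :
    -- the on-site phases are 2-cocycles, compatible with translation up to coboundaries
    (∀ j : ZMod L, ModulatedMPS.IsTwoCocycle (ν j) ∧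
      ModulatedMPS.EqUpToCoboundary (ν j) (fun g h => ν (j - 1) (T g) (T h))) ∧
    -- a symmetric injective MPS has bond unitaries, and their cocycles satisfy the constraints
    (∀ (D : ℕ) (_ : 0 < D) (A : Fin d → Matrix (Fin D) (Fin D) ℂ),
      ModulatedMPS.IsInjective A → ModulatedMPS.IsLeftCanonical A →
      ModulatedMPS.IsSymmetric U A →
        (∃ v : ZMod L → G → Matrix.unitaryGroup (Fin D) ℂ, ModulatedMPS.PushThrough U A v) ∧
        ∀ v : ZMod L → G → Matrix.unitaryGroup (Fin D) ℂ, ModulatedMPS.PushThrough U A v →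
          ModulatedMPS.IsCovariant T v ∧
          ∃ ω : ZMod L → G → G → Circle,
            ModulatedMPS.IsProjectiveRep v ω ∧
            (∀ j, ModulatedMPS.IsTwoCocycle (ω j)) ∧
            ModulatedMPS.SatisfiesConstraints T ν ω) ∧
    -- LSM-type obstruction
    ((¬ ∃ ω : ZMod L → G → G → Circle, (∀ j, ModulatedMPS.IsTwoCocycle (ω j)) ∧
        ModulatedMPS.SatisfiesConstraints T ν ω) →
      ¬ ∃ (D : ℕ) (_ : 0 < D) (A : Fin d → Matrix (Fin D) (Fin D) ℂ),
        ModulatedMPS.IsInjective A ∧ ModulatedMPS.IsSymmetric U A) := by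
  refine ⟨fun j => ⟨hν.isTwoCocycle hd j, hν.eqUpToCoboundary hd hU j⟩,
    fun D hD A hA hc hS => ⟨ModulatedMPS.exists_pushThrough hL hD hA hc hS,
      fun v hv => hv.constraints hL hD hν hU hA hc⟩, ?_⟩
  rintro hno ⟨D, hD, A, hA, hS⟩
  obtain ⟨A', hA', hc', hS'⟩ := ModulatedMPS.exists_leftCanonical hA hS
  obtain ⟨v, hv⟩ := ModulatedMPS.exists_pushThrough hL hD hA' hc' hS'
  obtain ⟨-, ω, -, hω, hcon⟩ := hv.constraints hL hD hν hU hA' hc'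
  exact hno ⟨ω, hω, hcon⟩
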